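/- Let $V$ be a simple vertex operator algebra over $\mathbb{C}$, and let $g$ be an automorphism of $V$ of finite order $n\ge 1$, i.e. an invertible linear map with $g\mathbf 1=\mathbf 1$ and $gY(u,z)g^{-1}=Y(gu,z)$ for all $u\in V$. Let $(M,Y_M)$ be an irreducible weak $V$-module, that is, an irreducible module for the vertex algebra underlying $V$ (no grading on $M$ is assumed). Let $M\cdot g$ be the weak $V$-module with underlying space $M$ and $Y_{M\cdot g}(v,z)=Y_M(gv,z)$ for $v\in V$, and assume that $M\cdot g\cong M$ as weak $V$-modules. Let $V^{\langle g\rangle}=\{v\in V : gv=v\}$, a vertex subalgebra of $V$. Then there are $V^{\langle g\rangle}$-submodules $M_1,\dots,M_n$ of $M$, each of them an irreducible $V^{\langle g\rangle}$-module and pairwise non-isomorphic as $V^{\langle g\rangle}$-modules, such that $$M=M_1\oplus\cdots\oplus M_n .$$ -/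

import Mathlib

open scoped VertexOperator

noncomputable section

/-- The Jacobi identity for a field map `YM` of `V` on `M`, where `Y` is the field map of `V` on
itself. Here `(YM u)[[n]]` is the mode `u_n`, that is `YM u = ∑ u_n z ^ (-n-1)`. The equation is the
equality of the coefficients of `z₀ ^ (-l-1) z₁ ^ (-m-1) z₂ ^ (-n-1)`, applied to `w`, on the two
sides of
`z₀⁻¹ δ((z₁-z₂)/z₀) YM(u,z₁) YM(v,z₂) - z₀⁻¹ δ((z₂-z₁)/(-z₀)) YM(v,z₂) YM(u,z₁)
  = z₂⁻¹ δ((z₁-z₀)/z₂) YM(Y(u,z₀)v,z₂)`.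
The three sums have finitely many nonzero terms because a `VertexOperator` takes values in
Laurent series, that is, `u_n w = 0` for large `n`. -/
def JacobiIdentity {V M : Type*} [AddCommGroup V] [Module ℂ V] [AddCommGroup M] [Module ℂ M]
    (Y : V →ₗ[ℂ] VertexOperator ℂ V) (YM : V →ₗ[ℂ] VertexOperator ℂ M) : Prop :=
  ∀ (u v : V) (l m n : ℤ) (w : M),
    (∑ᶠ i : ℕ, ((-1) ^ i * Ring.choose l i : ℤ) •
        ((YM u)[[m + l - i]]) (((YM v)[[n + i]]) w))
      - (l.negOnePow : ℤ) • (∑ᶠ i : ℕ, ((-1) ^ i * Ring.choose l i : ℤ) •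
        ((YM v)[[n + l - i]]) (((YM u)[[m + i]]) w))
    = ∑ᶠ i : ℕ, (Ring.choose m i : ℤ) •
        ((YM (((Y u)[[l + i]]) v))[[m + n - i]]) w

/-- A vertex algebra structure on the complex vector space `V`. The condition that `u_n v = 0` for
`n` large is part of the type `VertexOperator ℂ V` (maps to Laurent series). -/
class VertexAlgebra (V : Type*) [AddCommGroup V] [Module ℂ V] where
  /-- The state-field correspondence `v ↦ Y(v, z)`. -/
  Y : V →ₗ[ℂ] VertexOperator ℂ V
  /-- The vacuum vector. -/
  vacuum : V
  vacuum_mode : ∀ n : ℤ, (Y vacuum)[[n]] = if n = -1 then 1 else 0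
  mode_vacuum_of_nonneg : ∀ (v : V) (n : ℤ), 0 ≤ n → ((Y v)[[n]]) vacuum = 0
  mode_neg_one_vacuum : ∀ v : V, ((Y v)[[-1]]) vacuum = v
  jacobi : JacobiIdentity Y Y

/-- A vertex operator algebra structure on the complex vector space `V`. -/
class VertexOperatorAlgebra (V : Type*) [AddCommGroup V] [Module ℂ V] extends
    VertexAlgebra V where
  /-- The homogeneous subspace of weight `n`. -/
  weightSpace : ℤ → Submodule ℂ V
  isInternal : DirectSum.IsInternal weightSpace
  finite_weightSpace : ∀ n : ℤ, Module.Finite ℂ (weightSpace n)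
  weightSpace_eq_bot : ∃ N : ℤ, ∀ n < N, weightSpace n = ⊥
  /-- The conformal vector. -/
  conformal : V
  /-- The central charge. -/
  centralCharge : ℂ
  /-- The Virasoro relations for `L(n) = ω_{n+1}`. -/
  virasoro : ∀ m n : ℤ,
    ((Y conformal)[[m + 1]]) * ((Y conformal)[[n + 1]])
        - ((Y conformal)[[n + 1]]) * ((Y conformal)[[m + 1]])
      = ((m : ℂ) - n) • ((Y conformal)[[m + n + 1]])
        + (if m + n = 0 then ((m : ℂ) ^ 3 - m) / 12 * centralCharge else 0) •
          (1 : Module.End ℂ V)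
  /-- `L(0)` acts on the subspace of weight `n` as `n`. -/
  L_zero : ∀ (n : ℤ) (v : V), v ∈ weightSpace n → ((Y conformal)[[1]]) v = (n : ℂ) • v
  /-- `Y(L(-1)v, z) = d/dz Y(v, z)`. -/
  L_neg_one : ∀ (v : V) (n : ℤ),
    (Y (((Y conformal)[[0]]) v))[[n]] = (-n : ℂ) • ((Y v)[[n - 1]])

/-- A module structure on the complex vector space `M` for the vertex algebra `V`. If `V` is a
vertex operator algebra, this is what is called a weak `V`-module. The condition that `u_n w = 0`
for `n` large is part of the type `VertexOperator ℂ M`. -/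
structure VertexModule (V M : Type*) [AddCommGroup V] [Module ℂ V] [VertexAlgebra V]
    [AddCommGroup M] [Module ℂ M] where
  /-- The map `v ↦ Y_M(v, z)`. -/
  Y : V →ₗ[ℂ] VertexOperator ℂ M
  vacuum_mode : ∀ n : ℤ, (Y VertexAlgebra.vacuum)[[n]] = if n = -1 then 1 else 0
  jacobi : JacobiIdentity VertexAlgebra.Y Y

/-- The restriction of a vertex operator on `M` to a subspace stable under all its modes. -/
def VertexOperator.restrict {M : Type*} [AddCommGroup M] [Module ℂ M] (A : VertexOperator ℂ M)
    (N : Submodule ℂ M) (h : ∀ (n : ℤ), ∀ w ∈ N, (A[[n]]) w ∈ N) : VertexOperator ℂ N :=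
  HVertexOperator.of_coeff
    (fun n => (HVertexOperator.coeff A n).restrict (fun w hw => by
      rw [VertexOperator.coeff_eq_ncoeff]; exact h _ w hw))
    (fun w => (HVertexOperator.coeff_isPWOsupport A (w : M)).mono (fun n hn => by
      simp only [Function.mem_support, ne_eq] at hn ⊢
      intro h0
      exact hn (Subtype.ext h0)))

theorem VertexOperator.restrict_ncoeff {M : Type*} [AddCommGroup M] [Module ℂ M]
    (A : VertexOperator ℂ M) (N : Submodule ℂ M) (h : ∀ (n : ℤ), ∀ w ∈ N, (A[[n]]) w ∈ N)
    (n : ℤ) (w : N) : ((((A.restrict N h)[[n]]) w : N) : M) = (A[[n]]) (w : M) := rfl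

/-- If the modes of `Y'`, `YM'` are those of `Y`, `YM` seen on subspaces, then the Jacobi identity
passes from the latter to the former. -/
theorem JacobiIdentity.of_injective {V V' M M' : Type*} [AddCommGroup V] [Module ℂ V]
    [AddCommGroup V'] [Module ℂ V'] [AddCommGroup M] [Module ℂ M] [AddCommGroup M'] [Module ℂ M']
    {Y : V →ₗ[ℂ] VertexOperator ℂ V} {YM : V →ₗ[ℂ] VertexOperator ℂ M}
    {Y' : V' →ₗ[ℂ] VertexOperator ℂ V'} {YM' : V' →ₗ[ℂ] VertexOperator ℂ M'}
    (h : JacobiIdentity Y YM) (f : V' →ₗ[ℂ] V) (k : M' →ₗ[ℂ] M) (hk : Function.Injective k)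
    (hf : ∀ (u v : V') (n : ℤ), f (((Y' u)[[n]]) v) = ((Y (f u))[[n]]) (f v))
    (hfk : ∀ (u : V') (n : ℤ) (w : M'), k (((YM' u)[[n]]) w) = ((YM (f u))[[n]]) (k w)) :
    JacobiIdentity Y' YM' := by
  have key : ∀ F : ℕ → M', k (∑ᶠ i, F i) = ∑ᶠ i, k (F i) := fun F =>
    AddMonoidHom.map_finsum_of_injective k.toAddMonoidHom hk F
  intro u v l m n w
  apply hk
  rw [map_sub, map_zsmul, key, key, key]
  simp only [map_zsmul, hfk, hf]
  exact h (f u) (f v) l m n (k w)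

namespace VertexAlgebra

/-- The automorphism group of a vertex algebra: the invertible linear maps `g` with `g 1 = 1` and
`g Y(u, z) g⁻¹ = Y(g u, z)`. -/
def Aut (V : Type*) [AddCommGroup V] [Module ℂ V] [VertexAlgebra V] : Subgroup (V ≃ₗ[ℂ] V) where
  carrier := {g | g vacuum = vacuum ∧
    ∀ (u v : V) (n : ℤ), g (((Y u)[[n]]) (g⁻¹ v)) = ((Y (g u))[[n]]) v}
  one_mem' := ⟨rfl, fun _ _ _ => rfl⟩
  mul_mem' := by
    rintro a b ⟨ha, ha'⟩ ⟨hb, hb'⟩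
    refine ⟨by rw [LinearEquiv.mul_apply, hb, ha], fun u v n => ?_⟩
    rw [mul_inv_rev, LinearEquiv.mul_apply, LinearEquiv.mul_apply, hb', ha',
      LinearEquiv.mul_apply]
  inv_mem' := by
    rintro a ⟨ha, ha'⟩
    refine ⟨?_, fun u v n => ?_⟩
    · have h : a⁻¹ (a (vacuum : V)) = vacuum := a.symm_apply_apply _
      rwa [ha] at h
    · have h := ha' (a⁻¹ u) (a v) n
      have h1 : a⁻¹ (a v) = v := a.symm_apply_apply v
      have h2 : a (a⁻¹ u) = u := a.apply_symm_apply u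
      rw [h1, h2] at h
      rw [inv_inv, ← h]
      exact a.symm_apply_apply _

variable {V : Type*} [AddCommGroup V] [Module ℂ V] [VertexAlgebra V]

theorem Aut.apply_vacuum (g : Aut V) : (g : V ≃ₗ[ℂ] V) vacuum = vacuum := g.2.1

theorem Aut.apply_mode (g : Aut V) (u v : V) (n : ℤ) :
    (g : V ≃ₗ[ℂ] V) (((Y u)[[n]]) v)
      = ((Y ((g : V ≃ₗ[ℂ] V) u))[[n]]) ((g : V ≃ₗ[ℂ] V) v) := by
  have h := g.2.2 u ((g : V ≃ₗ[ℂ] V) v) n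
  have h1 : (g : V ≃ₗ[ℂ] V)⁻¹ ((g : V ≃ₗ[ℂ] V) v) = v := LinearEquiv.symm_apply_apply _ v
  rwa [h1] at h

/-- The space `V ^ G` of vectors fixed by a group `G` of automorphisms. -/
def fixedPoints (G : Subgroup (Aut V)) : Submodule ℂ V where
  carrier := {v | ∀ g ∈ G, (g : V ≃ₗ[ℂ] V) v = v}
  add_mem' := fun {a b} ha hb g hg => by rw [map_add, ha g hg, hb g hg]
  zero_mem' := fun g _ => map_zero _
  smul_mem' := fun c v hv g hg => by rw [map_smul, hv g hg]

theorem mode_mem_fixedPoints (G : Subgroup (Aut V)) {u v : V} (hu : u ∈ fixedPoints G)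
    (hv : v ∈ fixedPoints G) (n : ℤ) : ((Y u)[[n]]) v ∈ fixedPoints G := fun g hg => by
  rw [Aut.apply_mode, hu g hg, hv g hg]

/-- `V ^ G` is a vertex algebra, with the vacuum and the modes of `V`. -/
instance (G : Subgroup (Aut V)) : VertexAlgebra (fixedPoints G) where
  Y :=
    { toFun := fun u => (Y (u : V)).restrict (fixedPoints G)
        (fun n _ hw => mode_mem_fixedPoints G u.2 hw n)
      map_add' := fun u v => by
        apply HVertexOperator.coeff_inj
        funext n
        ext w
        exact DFunLike.congr_fun (congrFun (congrArg HVertexOperator.coeff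
          (map_add (Y : V →ₗ[ℂ] VertexOperator ℂ V) (u : V) v)) n) (w : V)
      map_smul' := fun c v => by
        apply HVertexOperator.coeff_inj
        funext n
        ext w
        exact DFunLike.congr_fun (congrFun (congrArg HVertexOperator.coeff
          (map_smul (Y : V →ₗ[ℂ] VertexOperator ℂ V) c (v : V))) n) (w : V) }
  vacuum := ⟨vacuum, fun g _ => Aut.apply_vacuum g⟩
  vacuum_mode := fun n => by
    ext w
    have h := DFunLike.congr_fun (vacuum_mode (V := V) n) (w : V)
    refine Eq.trans h ?_
    split_ifs <;> rfl
  mode_vacuum_of_nonneg := fun v n hn => Subtype.ext (mode_vacuum_of_nonneg (v : V) n hn)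
  mode_neg_one_vacuum := fun v => Subtype.ext (mode_neg_one_vacuum (v : V))
  jacobi := (jacobi (V := V)).of_injective (fixedPoints G).subtype (fixedPoints G).subtype
    Subtype.val_injective (fun _ _ _ => rfl) (fun _ _ _ => rfl)

variable (V) in
/-- The adjoint module: `V` as a module for itself. -/
def adjoint : VertexModule V V where
  Y := Y
  vacuum_mode := vacuum_mode
  jacobi := jacobi

end VertexAlgebra

namespace VertexModule

variable {V M N : Type*} [AddCommGroup V] [Module ℂ V] [VertexAlgebra V]
  [AddCommGroup M] [Module ℂ M] [AddCommGroup N] [Module ℂ N]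

/-- Two modules for `V` are isomorphic (equivalent) if there is a linear isomorphism that commutes
with all modes. -/
def IsIso (A : VertexModule V M) (B : VertexModule V N) : Prop :=
  ∃ f : M ≃ₗ[ℂ] N, ∀ (v : V) (n : ℤ) (w : M), f (((A.Y v)[[n]]) w) = ((B.Y v)[[n]]) (f w)

/-- A subspace is a `V`-submodule if it is stable under all modes of all elements of `V`. -/
def IsSubmodule (A : VertexModule V M) (W : Submodule ℂ M) : Prop :=
  ∀ (v : V) (n : ℤ), ∀ w ∈ W, ((A.Y v)[[n]]) w ∈ W

/-- A module is irreducible if it is nonzero and has no submodules besides `0` and itself. -/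
def IsIrreducible (A : VertexModule V M) : Prop :=
  Nontrivial M ∧ ∀ W : Submodule ℂ M, A.IsSubmodule W → W = ⊥ ∨ W = ⊤

/-- A submodule as a module in its own right. -/
def ofSubmodule (A : VertexModule V M) (W : Submodule ℂ M) (hW : A.IsSubmodule W) :
    VertexModule V W where
  Y :=
    { toFun := fun u => (A.Y u).restrict W (hW u)
      map_add' := fun u v => by
        apply HVertexOperator.coeff_inj
        funext n
        ext w
        exact DFunLike.congr_fun (congrFun (congrArg HVertexOperator.coeff
          (map_add A.Y u v)) n) (w : M)
      map_smul' := fun c v => by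
        apply HVertexOperator.coeff_inj
        funext n
        ext w
        exact DFunLike.congr_fun (congrFun (congrArg HVertexOperator.coeff
          (map_smul A.Y c v)) n) (w : M) }
  vacuum_mode := fun n => by
    ext w
    have h := DFunLike.congr_fun (A.vacuum_mode n) (w : M)
    refine Eq.trans h ?_
    split_ifs <;> rfl
  jacobi := A.jacobi.of_injective LinearMap.id W.subtype Subtype.val_injective
    (fun _ _ _ => rfl) (fun _ _ _ => rfl)

/-- The module `M · g`: the space `M` with `Y_{M · g}(v, z) = Y_M(g v, z)`. -/
def twist (A : VertexModule V M) (g : VertexAlgebra.Aut V) : VertexModule V M where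
  Y := A.Y ∘ₗ ((g : V ≃ₗ[ℂ] V) : V →ₗ[ℂ] V)
  vacuum_mode := fun n => by
    rw [← A.vacuum_mode n, LinearMap.comp_apply, LinearEquiv.coe_coe,
      VertexAlgebra.Aut.apply_vacuum]
  jacobi := A.jacobi.of_injective ((g : V ≃ₗ[ℂ] V) : V →ₗ[ℂ] V) LinearMap.id
    Function.injective_id (fun u v n => VertexAlgebra.Aut.apply_mode g u v n) (fun _ _ _ => rfl)

/-- A `V`-module as a module for the fixed point subalgebra `V ^ G`. -/
def restrictFixedPoints (A : VertexModule V M) (G : Subgroup (VertexAlgebra.Aut V)) :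
    VertexModule (VertexAlgebra.fixedPoints G) M where
  Y := A.Y ∘ₗ (VertexAlgebra.fixedPoints G).subtype
  vacuum_mode := A.vacuum_mode
  jacobi := A.jacobi.of_injective (VertexAlgebra.fixedPoints G).subtype LinearMap.id
    Function.injective_id (fun _ _ _ => rfl) (fun _ _ _ => rfl)

end VertexModule

/-- `V` is simple if it is irreducible as a module for itself. (For a vertex operator algebra, this
says that `V` is nonzero and has no proper nonzero ideals.) -/
def VertexAlgebra.IsSimple (V : Type*) [AddCommGroup V] [Module ℂ V] [VertexAlgebra V] : Prop :=
  (VertexAlgebra.adjoint V).IsIrreducible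

end

/-! An isomorphism `M · g ≅ M` is an operator `f` on `M` that intertwines `v_k` with `(g⁻¹v)_k`.
Then `f ^ n` commutes with `V`, so by Schur's lemma it is a scalar, and `f` can be rescaled so that
`f ^ n = 1`. The summands are the eigenspaces of `f` for the `n`-th roots of unity. As `M` carries
no grading, Schur's lemma rests on `M` having countable dimension while `ℂ` is uncountable.

Nonvanishing: in the simple case `Y(v, z)w ≠ 0` for nonzero `v` and `w`. Hence the eigenvalues of
`g⁻¹` on `V` form a group, necessarily all `n`-th roots of unity, and eigenvectors in `V` carry any
nonzero eigenspace of `f` to any other.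

Irreducibility: by associativity the single modes `v_k w` of one nonzero `w` already span `M`.
Projecting to the eigenspace of `w` replaces `v` by its average over `⟨g⟩`, so the modes of fixed
vectors span that eigenspace.

Non-isomorphism: an isomorphism sending `w` to `w'` between different eigenspaces would extend to a
well-defined `V`-endomorphism `T w ↦ T w'` of `M`. By Schur, `w'` would be a multiple of `w`,
contradicting the eigenvalues. -/

theorem VertexOperator.exists_forall_ncoeff_eq_zero {M : Type*} [AddCommGroup M] [Module ℂ M]
    (A : VertexOperator ℂ M) (w : M) : ∃ N : ℤ, ∀ k, N ≤ k → (A[[k]]) w = 0 :=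
  ⟨-HahnSeries.order ((HahnModule.of ℂ).symm (A w)), fun k hk =>
    ncoeff_eq_zero_of_lt_order A k w (by lia)⟩

/-! ### Products of modes, submodules generated by one vector, nonvanishing of `Y(v, z)w` -/

namespace VertexModule

variable {V M : Type*} [AddCommGroup V] [Module ℂ V] [VertexAlgebra V]
  [AddCommGroup M] [Module ℂ M]

/-- The span of the modes of a module, as a space of endomorphisms. -/
def modeSpan (A : VertexModule V M) : Submodule ℂ (Module.End ℂ M) :=
  Submodule.span ℂ (Set.range fun x : V × ℤ => (A.Y x.1)[[x.2]])

theorem mode_mem_modeSpan (A : VertexModule V M) (v : V) (k : ℤ) : (A.Y v)[[k]] ∈ A.modeSpan :=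
  Submodule.subset_span ⟨(v, k), rfl⟩

/-- Descending induction on `q`, measured by `d`: for `q ≥ N` the product kills `w`. The operator
`T` depends only on `u, v, p, q, N` and not on `w`, which later allows two vectors to be treated
simultaneously. -/
theorem exists_mode_mul_mode_eq_aux (A : VertexModule V M) (u v : V) (N : ℤ) (d : ℕ) :
    ∀ p q : ℤ, N ≤ q + d → ∃ T ∈ A.modeSpan, ∀ w : M,
      (∀ k, N ≤ k → ((A.Y u)[[k]]) w = 0) → (∀ k, N ≤ k → ((A.Y v)[[k]]) w = 0) →
        ((A.Y u)[[p]]) (((A.Y v)[[q]]) w) = T w := by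
  induction d using Nat.strong_induction_on with
  | _ d ih =>
    intro p q hq
    obtain rfl | hd := Nat.eq_zero_or_pos d
    · exact ⟨0, zero_mem _, fun w _ hv => by rw [hv q (by simpa using hq)]; simp⟩
    obtain ⟨K, hK⟩ := (VertexAlgebra.Y u).exists_forall_ncoeff_eq_zero v
    have ih' : ∀ i : ℕ, ∃ T ∈ A.modeSpan, ∀ w : M,
        (∀ k, N ≤ k → ((A.Y u)[[k]]) w = 0) → (∀ k, N ≤ k → ((A.Y v)[[k]]) w = 0) →
        ((A.Y u)[[p - (i + 1)]]) (((A.Y v)[[q + (i + 1)]]) w) = T w := fun i => by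
      by_cases hi : N ≤ q + (i + 1)
      · exact ⟨0, zero_mem _, fun w _ hv => by rw [hv _ hi]; simp⟩
      · exact ih (d - (i + 1)) (by lia) _ _ (by lia)
    choose T hT hTw using ih'
    refine ⟨∑ i ∈ Finset.range (K - (p - N)).toNat,
      (Ring.choose N i : ℤ) • (A.Y (((VertexAlgebra.Y u)[[p - N + i]]) v))[[N + q - i]]
      - ∑ i ∈ Finset.range d,
        ((-1) ^ (i + 1) * Ring.choose (p - N) (i + 1) : ℤ) • T i, ?_, fun w hu hv => ?_⟩
    · refine sub_mem (sum_mem fun i _ => zsmul_mem (A.mode_mem_modeSpan _ _) _)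
        (sum_mem fun i _ => zsmul_mem (hT i) _)
    -- With these indices the second sum contains only `u_{N+i} w = 0`, and the first is `u_p v_q w`
    -- plus terms in `u_{p-i} v_{q+i} w` with `i ≥ 1`, which the induction covers.
    have hJ := A.jacobi u v (p - N) N q w
    have h1 : (∑ᶠ i : ℕ, ((-1) ^ i * Ring.choose (p - N) i : ℤ) •
        ((A.Y v)[[q + (p - N) - i]]) (((A.Y u)[[N + i]]) w)) = 0 := by
      refine finsum_eq_zero_of_forall_eq_zero fun i => ?_
      rw [hu _ (by lia)]; simp
    have h2 : (∑ᶠ i : ℕ, ((-1) ^ i * Ring.choose (p - N) i : ℤ) •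
        ((A.Y u)[[N + (p - N) - i]]) (((A.Y v)[[q + i]]) w)) =
        ∑ i ∈ Finset.range (d + 1), ((-1) ^ i * Ring.choose (p - N) i : ℤ) •
        ((A.Y u)[[N + (p - N) - i]]) (((A.Y v)[[q + i]]) w) := by
      refine finsum_eq_sum_of_support_subset _ fun i hi => ?_
      by_contra hi'
      refine hi ?_
      simp only [Finset.coe_range, Set.mem_Iio, not_lt] at hi'
      simp only []
      rw [hv _ (by lia)]; simp
    have h3 : (∑ᶠ i : ℕ, (Ring.choose N i : ℤ) •
        ((A.Y (((VertexAlgebra.Y u)[[p - N + i]]) v))[[N + q - i]]) w) =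
        ∑ i ∈ Finset.range (K - (p - N)).toNat, (Ring.choose N i : ℤ) •
        ((A.Y (((VertexAlgebra.Y u)[[p - N + i]]) v))[[N + q - i]]) w := by
      refine finsum_eq_sum_of_support_subset _ fun i hi => ?_
      by_contra hi'
      refine hi ?_
      simp only [Finset.coe_range, Set.mem_Iio, not_lt] at hi'
      simp only []
      rw [hK _ (by lia)]; simp
    rw [h1, h2, h3, smul_zero, sub_zero, Finset.sum_range_succ'] at hJ
    have h4 : ∀ i : ℕ, ((A.Y u)[[N + (p - N) - ((i + 1 : ℕ) : ℤ)]])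
        (((A.Y v)[[q + ((i + 1 : ℕ) : ℤ)]]) w) = T i w := fun i => by
      rw [← hTw i w hu hv]
      rw [show N + (p - N) - ((i + 1 : ℕ) : ℤ) = p - (i + 1) by push_cast; ring]
      simp
    simp only [h4] at hJ
    simp only [LinearMap.sub_apply, LinearMap.sum_apply, LinearMap.smul_apply, ← hJ]
    simp

/-- A product of two modes acts on all vectors killed by the modes of high index as one and the
same linear combination of modes. -/
theorem exists_mode_mul_mode_eq (A : VertexModule V M) (u v : V) (p q N : ℤ) :
    ∃ T ∈ A.modeSpan, ∀ w : M,
      (∀ k, N ≤ k → ((A.Y u)[[k]]) w = 0) → (∀ k, N ≤ k → ((A.Y v)[[k]]) w = 0) →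
        ((A.Y u)[[p]]) (((A.Y v)[[q]]) w) = T w :=
  A.exists_mode_mul_mode_eq_aux u v N (N - q).toNat p q (by lia)

/-- One bound `N` serves both vectors, so a single `S` represents the product on both. This makes `T
w ↦ T w'` compatible with modes. -/
theorem exists_mode_mul_eq (A : VertexModule V M) (u : V) (p : ℤ) {T : Module.End ℂ M}
    (hT : T ∈ A.modeSpan) (w w' : M) : ∃ S ∈ A.modeSpan,
      ((A.Y u)[[p]]) (T w) = S w ∧ ((A.Y u)[[p]]) (T w') = S w' := by
  induction hT using Submodule.span_induction with
  | mem T hT =>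
    obtain ⟨⟨v, q⟩, rfl⟩ := hT
    obtain ⟨N₁, h₁⟩ := (A.Y u).exists_forall_ncoeff_eq_zero w
    obtain ⟨N₂, h₂⟩ := (A.Y v).exists_forall_ncoeff_eq_zero w
    obtain ⟨N₃, h₃⟩ := (A.Y u).exists_forall_ncoeff_eq_zero w'
    obtain ⟨N₄, h₄⟩ := (A.Y v).exists_forall_ncoeff_eq_zero w'
    obtain ⟨T, hT, h⟩ := A.exists_mode_mul_mode_eq u v p q (max (max N₁ N₂) (max N₃ N₄))
    exact ⟨T, hT, h w (fun k hk => h₁ k (by lia)) (fun k hk => h₂ k (by lia)),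
      h w' (fun k hk => h₃ k (by lia)) (fun k hk => h₄ k (by lia))⟩
  | zero => exact ⟨0, zero_mem _, by simp, by simp⟩
  | add T₁ T₂ _ _ h₁ h₂ =>
    obtain ⟨S₁, hS₁, e₁, e₁'⟩ := h₁
    obtain ⟨S₂, hS₂, e₂, e₂'⟩ := h₂
    exact ⟨S₁ + S₂, add_mem hS₁ hS₂, by simp [e₁, e₂], by simp [e₁', e₂']⟩
  | smul c T _ h =>
    obtain ⟨S, hS, e, e'⟩ := h
    exact ⟨c • S, Submodule.smul_mem _ c hS, by simp [e], by simp [e']⟩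

/-- The span of `v_k w` for `w` fixed is a submodule. -/
theorem isSubmodule_map_modeSpan (A : VertexModule V M) (w : M) :
    A.IsSubmodule (A.modeSpan.map (LinearMap.applyₗ w)) := by
  rintro u p _ ⟨T, hT, rfl⟩
  obtain ⟨S, hS, h, -⟩ := A.exists_mode_mul_eq u p hT w w
  exact ⟨S, hS, h.symm⟩

theorem one_mem_modeSpan (A : VertexModule V M) : 1 ∈ A.modeSpan := by
  simpa [A.vacuum_mode] using A.mode_mem_modeSpan VertexAlgebra.vacuum (-1)

theorem IsSubmodule.apply_mem {A : VertexModule V M} {W : Submodule ℂ M} (hW : A.IsSubmodule W)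
    {T : Module.End ℂ M} (hT : T ∈ A.modeSpan) {w : M} (hw : w ∈ W) : T w ∈ W := by
  induction hT using Submodule.span_induction with
  | mem T hT =>
    obtain ⟨⟨v, k⟩, rfl⟩ := hT
    exact hW v k w hw
  | zero => exact zero_mem _
  | add S T _ _ hS hT => exact add_mem hS hT
  | smul c T _ hT => exact Submodule.smul_mem _ c hT

theorem apply_mem_map_modeSpan (A : VertexModule V M) (w : M) :
    w ∈ A.modeSpan.map (LinearMap.applyₗ w) :=
  ⟨1, A.one_mem_modeSpan, rfl⟩

theorem IsIrreducible.map_modeSpan_eq_top {A : VertexModule V M} (hA : A.IsIrreducible) {w : M}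
    (hw : w ≠ 0) : A.modeSpan.map (LinearMap.applyₗ w) = ⊤ :=
  (hA.2 _ (A.isSubmodule_map_modeSpan w)).resolve_left fun h =>
    hw ((Submodule.mem_bot ℂ).1 (h ▸ A.apply_mem_map_modeSpan w))

/-- A form of weak commutativity: for `L` with `u_j v = 0` whenever `j ≥ L`, the Jacobi identity
leaves only a combination of the `v_{p-i} u_{m+i} w`. The terms with `i ≥ 1` vanish by descending
induction on `m`. -/
theorem mode_mode_eq_zero_aux (A : VertexModule V M) {u v : V} {w : M}
    (hv : ∀ k, ((A.Y v)[[k]]) w = 0) (N : ℤ) (hN : ∀ k, N ≤ k → ((A.Y u)[[k]]) w = 0) (d : ℕ) :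
    ∀ m p : ℤ, N ≤ m + d → ((A.Y v)[[p]]) (((A.Y u)[[m]]) w) = 0 := by
  induction d using Nat.strong_induction_on with
  | _ d ih =>
    intro m p hm
    obtain rfl | hd := Nat.eq_zero_or_pos d
    · rw [hN m (by simpa using hm), map_zero]
    obtain ⟨L, hL⟩ := (VertexAlgebra.Y u).exists_forall_ncoeff_eq_zero v
    have hJ := A.jacobi u v L m (p - L) w
    have hR : (∑ᶠ i : ℕ, (Ring.choose m i : ℤ) •
        ((A.Y (((VertexAlgebra.Y u)[[L + i]]) v))[[m + (p - L) - i]]) w) = 0 :=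
      finsum_eq_zero_of_forall_eq_zero fun i => by rw [hL _ (by lia)]; simp
    rw [finsum_eq_zero_of_forall_eq_zero (fun i => by rw [hv]; simp), hR,
      finsum_eq_single _ 0] at hJ
    · have : ((L.negOnePow : ℤ)) • (((A.Y v)[[p]]) (((A.Y u)[[m]]) w)) = 0 := by
        simpa using hJ
      obtain h | h := Int.units_eq_one_or L.negOnePow <;> simpa [h] using this
    · intro i hi
      by_cases hi' : N ≤ m + i
      · rw [hN _ hi']; simp
      · rw [ih (d - i) (by lia) _ _ (by lia), smul_zero]

/-- The vectors killed by all modes of `v` form a submodule. -/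
def killedBy (A : VertexModule V M) (v : V) : Submodule ℂ M :=
  ⨅ k : ℤ, LinearMap.ker ((A.Y v)[[k]])

theorem mem_killedBy {A : VertexModule V M} {v : V} {w : M} :
    w ∈ A.killedBy v ↔ ∀ k, ((A.Y v)[[k]]) w = 0 := by
  simp [killedBy]

theorem isSubmodule_killedBy (A : VertexModule V M) (v : V) : A.IsSubmodule (A.killedBy v) := by
  intro u m w hw
  rw [mem_killedBy] at hw ⊢
  obtain ⟨N, hN⟩ := (A.Y u).exists_forall_ncoeff_eq_zero w
  exact fun p => A.mode_mode_eq_zero_aux hw N hN (N - m).toNat m p (by lia)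

/-- The annihilator of a module, as a subspace of the vertex algebra. -/
def annihilator (A : VertexModule V M) : Submodule ℂ V :=
  ⨅ k : ℤ, LinearMap.ker ((LinearMap.proj k ∘ₗ VertexOperator.ncoeff) ∘ₗ A.Y)

theorem mem_annihilator {A : VertexModule V M} {v : V} :
    v ∈ A.annihilator ↔ ∀ (k : ℤ) (w : M), ((A.Y v)[[k]]) w = 0 := by
  simp [annihilator, LinearMap.ext_iff]

/-- At `m = 0` the right side of the Jacobi identity is the single term `(u_l v)_k w`, and each term
on the left contains a mode of `v`. -/
theorem isSubmodule_annihilator (A : VertexModule V M) :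
    (VertexAlgebra.adjoint V).IsSubmodule A.annihilator := by
  intro u l v hv
  rw [mem_annihilator] at hv ⊢
  intro k w
  have hJ := A.jacobi u v l 0 k w
  rw [finsum_eq_zero_of_forall_eq_zero (fun i => by rw [hv]; simp),
    finsum_eq_zero_of_forall_eq_zero (fun i => by rw [hv]; simp),
    finsum_eq_single _ 0] at hJ
  · simpa [VertexAlgebra.adjoint] using hJ.symm
  · intro i hi
    rw [Ring.choose_zero_pos _ (by lia)]; simp

/-- If `V` is simple and `M` is irreducible, then `Y_M(v, z) w ≠ 0` for nonzero `v` and `w`. -/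
theorem IsIrreducible.exists_mode_ne_zero {A : VertexModule V M} (hA : A.IsIrreducible)
    (hV : VertexAlgebra.IsSimple V) {v : V} (hv : v ≠ 0) {w : M} (hw : w ≠ 0) :
    ∃ k : ℤ, ((A.Y v)[[k]]) w ≠ 0 := by
  by_contra! h
  have htop : A.killedBy v = ⊤ := (hA.2 _ (A.isSubmodule_killedBy v)).resolve_left fun hb =>
    hw ((Submodule.mem_bot ℂ).1 (hb ▸ mem_killedBy.2 h))
  have hann : v ∈ A.annihilator := mem_annihilator.2 fun k x =>
    mem_killedBy.1 (htop ▸ Submodule.mem_top : x ∈ A.killedBy v) k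
  obtain hb | ht := hV.2 _ A.isSubmodule_annihilator
  · exact hv ((Submodule.mem_bot ℂ).1 (hb ▸ hann))
  · have h1 : VertexAlgebra.vacuum ∈ A.annihilator := ht ▸ Submodule.mem_top
    have h2 := mem_annihilator.1 h1 (-1) w
    rw [A.vacuum_mode] at h2
    exact hw (by simpa using h2)

end VertexModule

/-! ### Schur's lemma in countable dimension -/

/-- An endomorphism of a nonzero complex vector space of countable dimension has a nonempty
spectrum. -/
theorem Module.End.spectrum_nonempty_of_countable_span {M : Type*} [AddCommGroup M] [Module ℂ M]
    [Nontrivial M] {s : Set M} (hs : s.Countable) (hspan : Submodule.span ℂ s = ⊤)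
    (T : Module.End ℂ M) : (spectrum ℂ T).Nonempty := by
  classical
  by_contra hne
  rw [Set.not_nonempty_iff_eq_empty] at hne
  have hunit : ∀ a : ℂ, IsUnit (T - algebraMap ℂ (Module.End ℂ M) a) := fun a => by
    have h : a ∉ spectrum ℂ T := hne ▸ Set.notMem_empty a
    rw [spectrum.notMem_iff] at h
    simpa using h.neg
  have hpoly : ∀ p : Polynomial ℂ, p ≠ 0 → IsUnit (Polynomial.aeval T p) := fun p hp => by
    by_contra hnu
    rw [(IsAlgClosed.splits p).eq_prod_roots, map_mul, Polynomial.aeval_C] at hnu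
    have hc : IsUnit (algebraMap ℂ (Module.End ℂ M) p.leadingCoeff) :=
      (IsUnit.mk0 _ (Polynomial.leadingCoeff_ne_zero.2 hp)).map _
    obtain ⟨k, hk, -⟩ := spectrum.exists_mem_of_not_isUnit_aeval_prod
      (fun h => hnu (hc.mul h))
    exact (hne ▸ hk : k ∈ (∅ : Set ℂ))
  obtain ⟨w, hw⟩ := exists_ne (0 : M)
  choose R hR using fun a => (hunit a).exists_right_inv
  -- If the spectrum were empty, the resolvent vectors `(T - a)⁻¹ w` would form an uncountable
  -- independent family.
  have hli : LinearIndependent ℂ fun a : ℂ => R a w := by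
    refine linearIndependent_iff'.2 fun t m hm i hi => ?_
    -- Clearing denominators in a relation `∑ m a • R a w = 0` gives `p(T) w = 0`, so `p = 0`
    -- because nonzero polynomials in `T` are invertible. Evaluation at `i` then isolates `m i`.
    let p : Polynomial ℂ := ∑ a ∈ t, Polynomial.C (m a) *
      ∏ b ∈ t.erase a, (Polynomial.X - Polynomial.C b)
    have hterm : ∀ a ∈ t, Polynomial.aeval T
        (Polynomial.C (m a) * ∏ b ∈ t.erase a, (Polynomial.X - Polynomial.C b)) w =
        Polynomial.aeval T (∏ b ∈ t, (Polynomial.X - Polynomial.C b)) (m a • R a w) := by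
      intro a ha
      rw [← Finset.prod_erase_mul _ _ ha, map_mul, map_mul, Module.End.mul_apply,
        Module.End.mul_apply, map_smul]
      have h := LinearMap.congr_fun (hR a) w
      simp only [map_sub, Polynomial.aeval_X, Polynomial.aeval_C]
      rw [Module.End.mul_apply, Module.End.one_apply] at h
      rw [h, map_smul, Module.algebraMap_end_apply]
    have hp0 : Polynomial.aeval T p w = 0 := by
      simp only [p, map_sum, LinearMap.sum_apply]
      rw [Finset.sum_congr rfl hterm, ← map_sum, hm, map_zero]
    have hp : p = 0 := by
      by_contra hp
      refine hw (((Module.End.isUnit_iff _).1 (hpoly p hp)).1 ?_)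
      rw [hp0, map_zero]
    have hev := congrArg (Polynomial.eval i) hp
    simp only [p, Polynomial.eval_finsetSum, Polynomial.eval_mul, Polynomial.eval_C,
      Polynomial.eval_prod, Polynomial.eval_sub, Polynomial.eval_X, Polynomial.eval_zero] at hev
    have hzero : ∀ a ∈ t, a ≠ i → m a * ∏ b ∈ t.erase a, (i - b) = 0 := fun a _ hai => by
      rw [Finset.prod_eq_zero (Finset.mem_erase.2 ⟨hai.symm, hi⟩) (sub_self i), mul_zero]
    rw [Finset.sum_eq_single_of_mem i hi hzero] at hev
    exact (mul_eq_zero.1 hev).resolve_right (Finset.prod_ne_zero_iff.2 fun b hb =>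
      sub_ne_zero.2 (Finset.ne_of_mem_erase hb).symm)
  have hrank : Module.rank ℂ M ≤ Cardinal.aleph0 := by
    rw [← rank_top, ← hspan]
    exact (rank_span_le s).trans hs.le_aleph0
  have h := hli.cardinal_lift_le_rank.trans (Cardinal.lift_le.2 hrank)
  rw [Cardinal.mk_complex, Cardinal.lift_continuum, Cardinal.lift_aleph0] at h
  exact absurd h (not_le.2 Cardinal.aleph0_lt_continuum)

theorem VertexOperatorAlgebra.exists_countable_span_eq_top (V : Type*) [AddCommGroup V]
    [Module ℂ V] [VertexOperatorAlgebra V] :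
    ∃ s : Set V, s.Countable ∧ Submodule.span ℂ s = ⊤ := by
  have h : ∀ n : ℤ, ∃ s : Set V, s.Finite ∧ Submodule.span ℂ s = weightSpace n := fun n =>
    Submodule.fg_def.1 (Module.Finite.iff_fg.1 (finite_weightSpace n))
  choose s hs hspan using h
  refine ⟨⋃ n, s n, Set.countable_iUnion fun n => (hs n).countable, ?_⟩
  rw [Submodule.span_iUnion]
  simp only [hspan]
  exact (isInternal (V := V)).submodule_iSup_eq_top

namespace VertexModule

variable {V M : Type*} [AddCommGroup V] [Module ℂ V] [AddCommGroup M] [Module ℂ M]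

theorem IsIrreducible.exists_countable_span_eq_top [VertexAlgebra V] {s : Set V}
    (hs : s.Countable) (hspan : Submodule.span ℂ s = ⊤) {A : VertexModule V M}
    (hA : A.IsIrreducible) : ∃ t : Set M, t.Countable ∧ Submodule.span ℂ t = ⊤ := by
  have := hA.1
  obtain ⟨w, hw⟩ := exists_ne (0 : M)
  refine ⟨⋃ k : ℤ, (fun v => ((A.Y v)[[k]]) w) '' s,
    Set.countable_iUnion fun k => hs.image _, ?_⟩
  rw [eq_top_iff, ← hA.map_modeSpan_eq_top hw, modeSpan, Submodule.map_span, Submodule.span_le]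
  rintro _ ⟨_, ⟨⟨v, k⟩, rfl⟩, rfl⟩
  have hv : v ∈ Submodule.span ℂ s := hspan ▸ Submodule.mem_top
  simp only [LinearMap.applyₗ_apply_apply, SetLike.mem_coe]
  induction hv using Submodule.span_induction with
  | mem v hv => exact Submodule.subset_span (Set.mem_iUnion.2 ⟨k, v, hv, rfl⟩)
  | zero => simp
  | add x y _ _ hx hy => simpa using add_mem hx hy
  | smul c x _ hx => simpa using Submodule.smul_mem _ c hx

/-- **Schur's lemma** for irreducible weak modules of a vertex operator algebra. -/
theorem IsIrreducible.exists_eq_smul [VertexOperatorAlgebra V] {A : VertexModule V M}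
    (hA : A.IsIrreducible) (T : Module.End ℂ M)
    (hT : ∀ (v : V) (k : ℤ) (w : M), T (((A.Y v)[[k]]) w) = ((A.Y v)[[k]]) (T w)) :
    ∃ c : ℂ, ∀ w, T w = c • w := by
  have := hA.1
  obtain ⟨s, hs, hspan⟩ := VertexOperatorAlgebra.exists_countable_span_eq_top V
  obtain ⟨t, ht, htspan⟩ := hA.exists_countable_span_eq_top hs hspan
  obtain ⟨c, hc⟩ := Module.End.spectrum_nonempty_of_countable_span ht htspan T
  refine ⟨c, fun w => ?_⟩
  set S := algebraMap ℂ (Module.End ℂ M) c - T with hS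
  have hcomm : ∀ (v : V) (k : ℤ) (w : M), S (((A.Y v)[[k]]) w) = ((A.Y v)[[k]]) (S w) := by
    intro v k w
    simp [hS, hT]
  have hker : A.IsSubmodule (LinearMap.ker S) := fun v k w hw => by
    rw [LinearMap.mem_ker] at hw ⊢
    rw [hcomm, hw, map_zero]
  have hrange : A.IsSubmodule (LinearMap.range S) := by
    rintro v k _ ⟨w, rfl⟩
    exact ⟨_, hcomm v k w⟩
  have hzero : S = 0 := by
    by_contra hne
    refine hc ((Module.End.isUnit_iff _).2 ⟨?_, ?_⟩)
    · exact LinearMap.ker_eq_bot.1 ((hA.2 _ hker).resolve_right fun h =>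
        hne (LinearMap.ker_eq_top.1 h))
    · exact LinearMap.range_eq_top.1 ((hA.2 _ hrange).resolve_left fun h =>
        hne (LinearMap.range_eq_bot.1 h))
  have := LinearMap.congr_fun hzero w
  simp only [hS, LinearMap.sub_apply, Module.algebraMap_end_apply, LinearMap.zero_apply] at this
  exact (sub_eq_zero.1 this).symm

end VertexModule

/-! ### Eigenspace decomposition of an operator of finite order -/

section FiniteOrder

variable {M : Type*} [AddCommGroup M] [Module ℂ M]

/-- For `f ^ n = 1` and `μ ^ n = 1`, the projection onto the `μ`-eigenspace of `f`. -/
noncomputable def Module.End.eigenProj (n : ℕ) (f : Module.End ℂ M) (μ : ℂ) : Module.End ℂ M :=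
  (n : ℂ)⁻¹ • ∑ k ∈ Finset.range n, (μ⁻¹) ^ k • f ^ k

theorem Module.End.eigenProj_apply (n : ℕ) (f : Module.End ℂ M) (μ : ℂ) (x : M) :
    f.eigenProj n μ x = (n : ℂ)⁻¹ • ∑ k ∈ Finset.range n, (μ⁻¹) ^ k • (f ^ k) x := by
  simp [eigenProj, LinearMap.sum_apply]

theorem Module.End.pow_apply_of_mem_eigenspace {f : Module.End ℂ M} {μ : ℂ} {x : M}
    (hx : x ∈ f.eigenspace μ) (k : ℕ) : (f ^ k) x = μ ^ k • x := by
  rw [Module.End.mem_eigenspace_iff] at hx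
  induction k with
  | zero => simp
  | succ k ih => rw [pow_succ', Module.End.mul_apply, ih, map_smul, hx, smul_smul, pow_succ]

theorem Module.End.eigenProj_apply_of_mem_eigenspace {n : ℕ} (hn : n ≠ 0) {f : Module.End ℂ M}
    {μ : ℂ} (hμ : μ ≠ 0) {x : M} (hx : x ∈ f.eigenspace μ) : f.eigenProj n μ x = x := by
  rw [eigenProj_apply]
  simp only [pow_apply_of_mem_eigenspace hx, smul_smul, ← mul_pow, inv_mul_cancel₀ hμ, one_pow,
    one_smul, Finset.sum_const, Finset.card_range]
  rw [← Nat.cast_smul_eq_nsmul ℂ, smul_smul, inv_mul_cancel₀ (Nat.cast_ne_zero.2 hn), one_smul]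

theorem Module.End.eigenProj_apply_mem_eigenspace {n : ℕ} {f : Module.End ℂ M} (hf : f ^ n = 1)
    {μ : ℂ} (hμ0 : μ ≠ 0) (hμ : μ ^ n = 1) (x : M) : f.eigenProj n μ x ∈ f.eigenspace μ := by
  rw [mem_eigenspace_iff, eigenProj_apply, map_smul, smul_comm, map_sum]
  congr 1
  have h1 : ∀ k ∈ Finset.range n, f ((μ⁻¹) ^ k • (f ^ k) x) =
      μ • ((μ⁻¹) ^ (k + 1) • (f ^ (k + 1)) x) := fun k _ => by
    rw [map_smul, smul_smul, pow_succ' f, Module.End.mul_apply, pow_succ', ← mul_assoc,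
      mul_inv_cancel₀ hμ0, one_mul]
  rw [Finset.sum_congr rfl h1, ← Finset.smul_sum]
  congr 1
  -- The sum is cyclic: the terms for `k = 0` and `k = n` agree since `f ^ n = 1` and `μ ^ n = 1`.
  have h2 := Finset.sum_range_succ (fun k => (μ⁻¹) ^ k • (f ^ k) x) n
  rw [Finset.sum_range_succ'] at h2
  simpa [hf, hμ] using h2

/-- Orthogonality of characters: after exchanging the sums, the coefficient of `f ^ k` is a
geometric sum that vanishes for `0 < k < n`. -/
theorem Module.End.sum_eigenProj_apply {n : ℕ} (hn : n ≠ 0) {ζ : ℂ} (hζ : IsPrimitiveRoot ζ n)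
    (f : Module.End ℂ M) (x : M) : ∑ i ∈ Finset.range n, f.eigenProj n (ζ ^ i) x = x := by
  have h : ∀ k ∈ Finset.range n, k ≠ 0 →
      ∑ i ∈ Finset.range n, ((ζ ^ i)⁻¹) ^ k • (f ^ k) x = 0 := fun k hk hk0 => by
    have hne : (ζ⁻¹) ^ k ≠ 1 := by
      rw [inv_pow, ne_eq, inv_eq_one]
      exact hζ.pow_ne_one_of_pos_of_lt hk0 (Finset.mem_range.1 hk)
    have hsum : ∑ i ∈ Finset.range n, ((ζ ^ i)⁻¹) ^ k = 0 := by
      have he : ∀ i ∈ Finset.range n, ((ζ ^ i)⁻¹) ^ k = ((ζ⁻¹) ^ k) ^ i := fun i _ => by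
        rw [← inv_pow, ← pow_mul, ← pow_mul, mul_comm]
      rw [Finset.sum_congr rfl he, geom_sum_eq hne, ← pow_mul, mul_comm, pow_mul, inv_pow,
        hζ.pow_eq_one]
      simp
    rw [← Finset.sum_smul, hsum, zero_smul]
  simp only [eigenProj_apply]
  rw [← Finset.smul_sum, Finset.sum_comm,
    Finset.sum_eq_single_of_mem 0 (Finset.mem_range.2 (Nat.pos_of_ne_zero hn)) h]
  simp only [pow_zero, one_smul, Module.End.one_apply, Finset.sum_const, Finset.card_range]
  rw [← Nat.cast_smul_eq_nsmul ℂ, smul_smul, inv_mul_cancel₀ (Nat.cast_ne_zero.2 hn), one_smul]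

theorem Module.End.isInternal_eigenspace_of_pow_eq_one {n : ℕ} (hn : n ≠ 0) {ζ : ℂ}
    (hζ : IsPrimitiveRoot ζ n) {f : Module.End ℂ M} (hf : f ^ n = 1) :
    DirectSum.IsInternal fun i : Fin n => f.eigenspace (ζ ^ (i : ℕ)) := by
  refine DirectSum.isInternal_submodule_of_iSupIndep_of_iSup_eq_top
    (f.eigenspaces_iSupIndep.comp (f := fun i : Fin n => ζ ^ (i : ℕ)) fun i j h =>
      Fin.ext (hζ.pow_inj i.2 j.2 h)) (eq_top_iff.2 fun x _ => ?_)
  rw [← Module.End.sum_eigenProj_apply hn hζ f x]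
  refine sum_mem fun i hi => Submodule.mem_iSup_of_mem (⟨i, Finset.mem_range.1 hi⟩ : Fin n) ?_
  refine eigenProj_apply_mem_eigenspace hf (pow_ne_zero _ (hζ.ne_zero hn)) ?_ x
  rw [← pow_mul, mul_comm, pow_mul, hζ.pow_eq_one, one_pow]

end FiniteOrder

/-! ### Eigenvalues of an automorphism of a simple vertex algebra -/

namespace VertexAlgebra

variable {V : Type*} [AddCommGroup V] [Module ℂ V] [VertexAlgebra V]

theorem vacuum_ne_zero [Nontrivial V] : (vacuum : V) ≠ 0 := fun h => by
  obtain ⟨v, hv⟩ := exists_ne (0 : V)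
  apply hv
  rw [← mode_neg_one_vacuum v, h, map_zero]

/-- Every `n`-th root of unity is an eigenvalue of an automorphism of order `n` of a simple
vertex algebra. -/
theorem IsSimple.exists_eigenvector (hV : IsSimple V) {γ : Module.End ℂ V}
    (hvac : γ vacuum = vacuum)
    (hmode : ∀ (u v : V) (k : ℤ), γ (((Y u)[[k]]) v) = ((Y (γ u))[[k]]) (γ v))
    {n : ℕ} (hn : n ≠ 0) (hγ : γ ^ n = 1) (hord : ∀ d, γ ^ d = 1 → n ∣ d) {μ : ℂ}
    (hμ : μ ^ n = 1) : ∃ v : V, v ≠ 0 ∧ γ v = μ • v := by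
  have := hV.1
  have : NeZero n := ⟨hn⟩
  have hone : ∃ v : V, v ≠ 0 ∧ γ v = (1 : ℂ) • v := ⟨vacuum, vacuum_ne_zero, by simp [hvac]⟩
  have hmul : ∀ a b : ℂ, (∃ v : V, v ≠ 0 ∧ γ v = a • v) → (∃ v : V, v ≠ 0 ∧ γ v = b • v) →
      ∃ v : V, v ≠ 0 ∧ γ v = (a * b) • v := by
    rintro a b ⟨u, hu, hau⟩ ⟨v, hv, hbv⟩
    obtain ⟨k, hk⟩ := VertexModule.IsIrreducible.exists_mode_ne_zero hV hV hu hv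
    refine ⟨((Y u)[[k]]) v, hk, ?_⟩
    rw [hmode, hau, hbv]
    simp [smul_smul, mul_comm]
  have hpow : ∀ (a : ℂ) (k : ℕ), (∃ v : V, v ≠ 0 ∧ γ v = a • v) →
      ∃ v : V, v ≠ 0 ∧ γ v = (a ^ k) • v := fun a k ha => by
    induction k with
    | zero => simpa using hone
    | succ k ih => rw [pow_succ]; exact hmul _ _ ih ha
  -- Products of eigenvalues are eigenvalues, since some `u_k v` of two eigenvectors is nonzero;
  -- inverses are powers.
  let H : Subgroup (rootsOfUnity n ℂ) :=
    { carrier := {a | ∃ v : V, v ≠ 0 ∧ γ v = ((a : ℂˣ) : ℂ) • v}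
      one_mem' := by simpa using hone
      mul_mem' := fun {a b} ha hb => by simpa using hmul _ _ ha hb
      inv_mem' := fun {a} ha => by
        have h : a⁻¹ = a ^ (n - 1) := by
          rw [inv_eq_iff_mul_eq_one, ← pow_succ', Nat.sub_add_cancel (Nat.pos_of_ne_zero hn)]
          exact Subtype.ext a.2
        rw [h]
        simpa using hpow _ (n - 1) ha }
  obtain ⟨ζ, hζ⟩ : ∃ ζ : ℂ, IsPrimitiveRoot ζ n := ⟨_, Complex.isPrimitiveRoot_exp n hn⟩
  -- Every eigenvalue that occurs lies in `H`, so Lagrange kills it on each eigencomponent. Then `n`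
  -- divides `Nat.card H`, which forces `H` to be everything.
  have hcard : γ ^ Nat.card H = 1 := by
    ext v
    rw [← Module.End.sum_eigenProj_apply hn hζ γ v, map_sum, Module.End.one_apply]
    refine Finset.sum_congr rfl fun i _ => ?_
    have hi : (ζ ^ i) ^ n = 1 := by rw [← pow_mul, mul_comm, pow_mul, hζ.pow_eq_one, one_pow]
    have hmem := Module.End.eigenProj_apply_mem_eigenspace hγ
      (pow_ne_zero _ (hζ.ne_zero hn)) hi v
    by_cases h0 : γ.eigenProj n (ζ ^ i) v = 0
    · rw [h0, map_zero]
    have ha : rootsOfUnity.mkOfPowEq (ζ ^ i) hi ∈ H :=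
      ⟨_, h0, by simpa using Module.End.mem_eigenspace_iff.1 hmem⟩
    have h1 : (ζ ^ i) ^ Nat.card H = 1 := by
      have h : rootsOfUnity.mkOfPowEq (ζ ^ i) hi ^ Nat.card H = 1 :=
        congrArg Subtype.val (pow_card_eq_one' (x := (⟨_, ha⟩ : H)))
      simpa only [Subgroup.coe_pow, Units.val_pow_eq_pow_val, rootsOfUnity.val_mkOfPowEq_coe,
        Subgroup.coe_one, Units.val_one] using
        congrArg (fun a : rootsOfUnity n ℂ => ((a : ℂˣ) : ℂ)) h
    rw [Module.End.pow_apply_of_mem_eigenspace hmem, h1, one_smul]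
  have htop : H = ⊤ := by
    refine Subgroup.eq_top_of_le_card H ?_
    exact (card_rootsOfUnity ℂ n).trans (Nat.le_of_dvd Nat.card_pos (hord _ hcard))
  have hmem : rootsOfUnity.mkOfPowEq μ hμ ∈ H := htop ▸ Subgroup.mem_top _
  obtain ⟨v, hv, h⟩ := hmem
  exact ⟨v, hv, by simpa using h⟩

end VertexAlgebra

/-! ### Eigenspaces of the intertwiner as modules for the fixed point subalgebra -/

namespace VertexModule

variable {V M : Type*} [AddCommGroup V] [Module ℂ V] [AddCommGroup M] [Module ℂ M]

section

variable [VertexAlgebra V] {A : VertexModule V M} {G : Subgroup (VertexAlgebra.Aut V)}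
  {γ : Module.End ℂ V} {f : Module.End ℂ M} {n : ℕ}

theorem pow_apply_mode
    (hf : ∀ (v : V) (k : ℤ) (w : M), f (((A.Y v)[[k]]) w) = ((A.Y (γ v))[[k]]) (f w))
    (t : ℕ) (v : V) (k : ℤ) (w : M) :
    (f ^ t) (((A.Y v)[[k]]) w) = ((A.Y ((γ ^ t) v))[[k]]) ((f ^ t) w) := by
  induction t with
  | zero => simp
  | succ t ih => simp only [pow_succ', Module.End.mul_apply, ih, hf]

/-- On an eigenvector `w`, projecting `v_k w` to the same eigenspace amounts to averaging `v`. -/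
theorem eigenProj_mode
    (hf : ∀ (v : V) (k : ℤ) (w : M), f (((A.Y v)[[k]]) w) = ((A.Y (γ v))[[k]]) (f w))
    {μ : ℂ} (hμ : μ ≠ 0) {w : M} (hw : w ∈ f.eigenspace μ) (v : V) (k : ℤ) :
    f.eigenProj n μ (((A.Y v)[[k]]) w) = ((A.Y (γ.eigenProj n 1 v))[[k]]) w := by
  rw [Module.End.eigenProj_apply, Module.End.eigenProj_apply]
  simp only [pow_apply_mode hf, Module.End.pow_apply_of_mem_eigenspace hw, map_smul, map_sum,
    smul_smul, ← mul_pow, inv_mul_cancel₀ hμ, inv_one, one_pow, one_smul, Pi.smul_apply,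
    Finset.sum_apply, LinearMap.smul_apply, LinearMap.sum_apply]

/-- Averaging `v` over the powers of `γ` does not involve the eigenvalue, so the same `S` works on
all eigenspaces at once. The comparison of two eigenspaces needs this uniformity. -/
theorem exists_eigenProj_eq
    (hf : ∀ (v : V) (k : ℤ) (w : M), f (((A.Y v)[[k]]) w) = ((A.Y (γ v))[[k]]) (f w))
    (hγ : γ ^ n = 1) (hfix : ∀ v, γ v = v ↔ v ∈ VertexAlgebra.fixedPoints G)
    {T : Module.End ℂ M} (hT : T ∈ A.modeSpan) :
    ∃ S ∈ (A.restrictFixedPoints G).modeSpan, ∀ μ : ℂ, μ ≠ 0 → ∀ w ∈ f.eigenspace μ,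
      f.eigenProj n μ (T w) = S w := by
  induction hT using Submodule.span_induction with
  | mem T hT =>
    obtain ⟨⟨v, k⟩, rfl⟩ := hT
    have hv : γ.eigenProj n 1 v ∈ VertexAlgebra.fixedPoints G := by
      rw [← hfix]
      simpa using Module.End.mem_eigenspace_iff.1
        (Module.End.eigenProj_apply_mem_eigenspace hγ one_ne_zero (one_pow n) v)
    exact ⟨_, (A.restrictFixedPoints G).mode_mem_modeSpan ⟨_, hv⟩ k,
      fun μ hμ w hw => eigenProj_mode hf hμ hw v k⟩
  | zero => exact ⟨0, zero_mem _, by simp⟩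
  | add T₁ T₂ _ _ h₁ h₂ =>
    obtain ⟨S₁, hS₁, e₁⟩ := h₁
    obtain ⟨S₂, hS₂, e₂⟩ := h₂
    exact ⟨S₁ + S₂, add_mem hS₁ hS₂, fun μ hμ w hw => by simp [e₁ μ hμ w hw, e₂ μ hμ w hw]⟩
  | smul c T _ h =>
    obtain ⟨S, hS, e⟩ := h
    exact ⟨c • S, Submodule.smul_mem _ c hS, fun μ hμ w hw => by simp [e μ hμ w hw]⟩

theorem isSubmodule_eigenspace
    (hf : ∀ (v : V) (k : ℤ) (w : M), f (((A.Y v)[[k]]) w) = ((A.Y (γ v))[[k]]) (f w))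
    (hfix : ∀ v, γ v = v ↔ v ∈ VertexAlgebra.fixedPoints G) (μ : ℂ) :
    (A.restrictFixedPoints G).IsSubmodule (f.eigenspace μ) := by
  intro v k w hw
  rw [Module.End.mem_eigenspace_iff] at hw ⊢
  change f (((A.Y (v : V))[[k]]) w) = μ • ((A.Y (v : V))[[k]]) w
  rw [hf, (hfix v).2 v.2, hw, map_smul]

/-- The eigenspaces of `f` are irreducible for the fixed point subalgebra. -/
theorem IsIrreducible.ofSubmodule_eigenspace (hA : A.IsIrreducible)
    (hf : ∀ (v : V) (k : ℤ) (w : M), f (((A.Y v)[[k]]) w) = ((A.Y (γ v))[[k]]) (f w))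
    (hn : n ≠ 0) (hγ : γ ^ n = 1) (hfix : ∀ v, γ v = v ↔ v ∈ VertexAlgebra.fixedPoints G)
    {μ : ℂ} (hμ : μ ≠ 0) (hne : f.eigenspace μ ≠ ⊥)
    (h : (A.restrictFixedPoints G).IsSubmodule (f.eigenspace μ)) :
    ((A.restrictFixedPoints G).ofSubmodule (f.eigenspace μ) h).IsIrreducible := by
  refine ⟨(Submodule.nontrivial_iff_ne_bot).2 hne, fun W hW => ?_⟩
  rw [or_iff_not_imp_left]
  intro hWne
  obtain ⟨w, hw, hw0⟩ := Submodule.exists_mem_ne_zero_of_ne_bot hWne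
  have hW' : (A.restrictFixedPoints G).IsSubmodule (W.map (f.eigenspace μ).subtype) := by
    rintro v k _ ⟨x, hx, rfl⟩
    exact ⟨_, hW v k x hx, rfl⟩
  refine eq_top_iff.2 fun x _ => ?_
  -- Reach `x` from `w` by modes of `V`, then project: `x` is its own projection, so modes of fixed
  -- vectors already suffice.
  obtain ⟨T, hT, hTx⟩ : (x : M) ∈ A.modeSpan.map (LinearMap.applyₗ (w : M)) := by
    rw [hA.map_modeSpan_eq_top fun h0 => hw0 (Subtype.ext h0)]
    exact Submodule.mem_top
  rw [LinearMap.applyₗ_apply_apply] at hTx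
  obtain ⟨S, hS, hTS⟩ := exists_eigenProj_eq hf hγ hfix hT
  have hxS : S w = (x : M) := by
    rw [← hTS μ hμ w w.2, hTx, Module.End.eigenProj_apply_of_mem_eigenspace hn hμ x.2]
  have hmem := hW'.apply_mem hS (⟨w, hw, rfl⟩ : (w : M) ∈ W.map (f.eigenspace μ).subtype)
  rw [hxS] at hmem
  obtain ⟨y, hy, hyx⟩ := hmem
  rwa [← Subtype.ext hyx]

theorem IsIrreducible.eigenspace_ne_bot (hV : VertexAlgebra.IsSimple V) (hA : A.IsIrreducible)
    (hf : ∀ (v : V) (k : ℤ) (w : M), f (((A.Y v)[[k]]) w) = ((A.Y (γ v))[[k]]) (f w))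
    (hvac : γ VertexAlgebra.vacuum = VertexAlgebra.vacuum)
    (hmode : ∀ (u v : V) (k : ℤ), γ (((VertexAlgebra.Y u)[[k]]) v) =
      ((VertexAlgebra.Y (γ u))[[k]]) (γ v))
    (hn : n ≠ 0) (hγ : γ ^ n = 1) (hord : ∀ d, γ ^ d = 1 → n ∣ d) (hfn : f ^ n = 1)
    {μ : ℂ} (hμ : μ ^ n = 1) : f.eigenspace μ ≠ ⊥ := by
  have := hA.1
  obtain ⟨ζ, hζ⟩ : ∃ ζ : ℂ, IsPrimitiveRoot ζ n := ⟨_, Complex.isPrimitiveRoot_exp n hn⟩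
  obtain ⟨i, hi⟩ : ∃ i : Fin n, f.eigenspace (ζ ^ (i : ℕ)) ≠ ⊥ := by
    by_contra! hbot
    have h := (Module.End.isInternal_eigenspace_of_pow_eq_one hn hζ hfn).submodule_iSup_eq_top
    simp [hbot] at h
  obtain ⟨w, hw, hw0⟩ := Submodule.exists_mem_ne_zero_of_ne_bot hi
  rw [Module.End.mem_eigenspace_iff] at hw
  have hζi : (ζ ^ (i : ℕ)) ^ n = 1 := by
    rw [← pow_mul, mul_comm, pow_mul, hζ.pow_eq_one, one_pow]
  -- The eigenvalue is the ratio that moves the eigenvector `w` into the `μ`-eigenspace.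
  obtain ⟨v, hv, hγv⟩ := hV.exists_eigenvector hvac hmode hn hγ hord
    (μ := μ * (ζ ^ (i : ℕ))⁻¹) (by rw [mul_pow, inv_pow, hμ, hζi]; simp)
  obtain ⟨k, hk⟩ := hA.exists_mode_ne_zero hV hv hw0
  refine (Submodule.ne_bot_iff _).2 ⟨_, ?_, hk⟩
  rw [Module.End.mem_eigenspace_iff, hf, hγv, hw]
  simp only [map_smul, Pi.smul_apply, LinearMap.smul_apply, smul_smul]
  rw [mul_left_comm, mul_inv_cancel₀ (pow_ne_zero _ (hζ.ne_zero hn)), mul_one]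

end

/-- Different eigenspaces of `f` are not isomorphic over the fixed point subalgebra. -/
theorem IsIrreducible.not_isIso_eigenspace [VertexOperatorAlgebra V] {A : VertexModule V M}
    {G : Subgroup (VertexAlgebra.Aut V)} {γ : Module.End ℂ V} {f : Module.End ℂ M} {n : ℕ}
    (hA : A.IsIrreducible)
    (hf : ∀ (v : V) (k : ℤ) (w : M), f (((A.Y v)[[k]]) w) = ((A.Y (γ v))[[k]]) (f w))
    (hn : n ≠ 0) (hγ : γ ^ n = 1) (hfix : ∀ v, γ v = v ↔ v ∈ VertexAlgebra.fixedPoints G)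
    {μ ν : ℂ} (hμ : μ ≠ 0) (hν : ν ≠ 0) (hμν : μ ≠ ν) (hne : f.eigenspace μ ≠ ⊥)
    (h : (A.restrictFixedPoints G).IsSubmodule (f.eigenspace μ))
    (h' : (A.restrictFixedPoints G).IsSubmodule (f.eigenspace ν)) :
    ¬ ((A.restrictFixedPoints G).ofSubmodule (f.eigenspace μ) h).IsIso
      ((A.restrictFixedPoints G).ofSubmodule (f.eigenspace ν) h') := by
  rintro ⟨φ, hφ⟩
  obtain ⟨w₀, hw₀⟩ : ∃ w : f.eigenspace μ, w ≠ 0 := by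
    obtain ⟨w, hw, hw0⟩ := Submodule.exists_mem_ne_zero_of_ne_bot hne
    exact ⟨⟨w, hw⟩, fun h0 => hw0 (congrArg Subtype.val h0)⟩
  have hw : (w₀ : M) ≠ 0 := fun h0 => hw₀ (Subtype.ext h0)
  set w := (w₀ : M)
  set w' := (φ w₀ : M)
  have hw' : w' ≠ 0 := fun h0 => hw₀ (φ.map_eq_zero_iff.1 (Subtype.ext h0))
  have hφS : ∀ S ∈ (A.restrictFixedPoints G).modeSpan,
      ∃ y : f.eigenspace μ, (y : M) = S w ∧ (φ y : M) = S w' := by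
    intro S hS
    induction hS using Submodule.span_induction with
    | mem S hS =>
      obtain ⟨⟨v, k⟩, rfl⟩ := hS
      exact ⟨_, rfl, congrArg Subtype.val (hφ v k w₀)⟩
    | zero => exact ⟨0, by simp⟩
    | add S T _ _ h₁ h₂ =>
      obtain ⟨y₁, e₁, e₁'⟩ := h₁
      obtain ⟨y₂, e₂, e₂'⟩ := h₂
      exact ⟨y₁ + y₂, by simp [e₁, e₂], by simp [e₁', e₂']⟩
    | smul c S _ h₁ =>
      obtain ⟨y, e, e'⟩ := h₁
      exact ⟨c • y, by simp [e], by simp [e']⟩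
  let E : A.modeSpan →ₗ[ℂ] M := LinearMap.applyₗ w ∘ₗ A.modeSpan.subtype
  let E' : A.modeSpan →ₗ[ℂ] M := LinearMap.applyₗ w' ∘ₗ A.modeSpan.subtype
  -- This makes `T w ↦ T w'` well defined. The vectors `T w'` with `T w = 0` form a `V`-submodule.
  -- If it were all of `M`, some `T` would have `T w = 0` and `T w' = w'`; projecting to eigenspaces
  -- replaces `T` by an `S` from the fixed point subalgebra, and `φ` would send `S w = 0` to `S w' =
  -- w' ≠ 0`.
  have hEE' : ∀ T, E T = 0 → E' T = 0 := by
    have hK : A.IsSubmodule ((LinearMap.ker E).map E') := by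
      rintro u p _ ⟨⟨T, hT⟩, hT0, rfl⟩
      obtain ⟨S, hS, e, e'⟩ := A.exists_mode_mul_eq u p hT w w'
      refine ⟨⟨S, hS⟩, ?_, e'.symm⟩
      have hT0' : T w = 0 := hT0
      have : S w = 0 := by rw [← e, hT0', map_zero]
      exact this
    obtain hbot | htop := hA.2 _ hK
    · exact fun T hT => (Submodule.mem_bot ℂ).1 (hbot ▸ ⟨T, hT, rfl⟩)
    · exfalso
      obtain ⟨⟨T, hT⟩, hT0, hT1⟩ : w' ∈ (LinearMap.ker E).map E' := htop ▸ Submodule.mem_top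
      have hT0' : T w = 0 := hT0
      have hT1' : T w' = w' := hT1
      obtain ⟨S, hS, hTS⟩ := exists_eigenProj_eq hf hγ hfix hT
      obtain ⟨y, hy, hy'⟩ := hφS S hS
      rw [← hTS μ hμ w w₀.2, hT0', map_zero] at hy
      rw [← hTS ν hν w' (φ w₀).2, hT1',
        Module.End.eigenProj_apply_of_mem_eigenspace hn hν (φ w₀).2] at hy'
      rw [show y = 0 from Subtype.ext hy, map_zero, Submodule.coe_zero] at hy'
      exact hw' hy'.symm
  have hEsurj : LinearMap.range E = ⊤ := by
    rw [LinearMap.range_comp, Submodule.range_subtype]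
    exact hA.map_modeSpan_eq_top hw
  -- `E' ∘ₗ r` is the map `T w ↦ T w'`, independent of the chosen section `r`.
  obtain ⟨r, hr⟩ := E.exists_rightInverse_of_surjective hEsurj
  have hψ : ∀ T, E' (r (E T)) = E' T := fun T => by
    rw [← sub_eq_zero, ← map_sub]
    exact hEE' _ (by rw [map_sub, sub_eq_zero]; exact LinearMap.congr_fun hr (E T))
  obtain ⟨c, hc⟩ := hA.exists_eq_smul (E' ∘ₗ r) (fun v k x => by
    obtain ⟨⟨T, hT⟩, rfl⟩ : ∃ T, E T = x := LinearMap.range_eq_top.1 hEsurj x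
    obtain ⟨S, hS, e, e'⟩ := A.exists_mode_mul_eq v k hT w w'
    have e₁ : ((A.Y v)[[k]]) (E ⟨T, hT⟩) = E ⟨S, hS⟩ := e
    have e₂ : ((A.Y v)[[k]]) (E' ⟨T, hT⟩) = E' ⟨S, hS⟩ := e'
    change E' (r (((A.Y v)[[k]]) (E ⟨T, hT⟩))) = ((A.Y v)[[k]]) (E' (r (E ⟨T, hT⟩)))
    rw [e₁, hψ, hψ, e₂])
  have hcw : w' = c • w := by
    rw [← hc w]
    exact (hψ ⟨1, A.one_mem_modeSpan⟩).symm
  have h1 : f w = μ • w := Module.End.mem_eigenspace_iff.1 w₀.2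
  have h2 : f w' = ν • w' := Module.End.mem_eigenspace_iff.1 (φ w₀).2
  rw [hcw, map_smul, h1, smul_comm, ← hcw] at h2
  exact hμν (smul_left_injective ℂ hw' h2)

/-- An intertwiner `M · g → M` for `g` of order `n` can be scaled to have order dividing `n`. -/
theorem IsIrreducible.exists_pow_eq_one [VertexOperatorAlgebra V] {A : VertexModule V M}
    (hA : A.IsIrreducible) {γ : Module.End ℂ V} {n : ℕ} (hn : n ≠ 0) (hγ : γ ^ n = 1)
    {f : Module.End ℂ M} (hinj : Function.Injective f)
    (hf : ∀ (v : V) (k : ℤ) (w : M), f (((A.Y v)[[k]]) w) = ((A.Y (γ v))[[k]]) (f w)) :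
    ∃ f' : Module.End ℂ M, f' ^ n = 1 ∧
      ∀ (v : V) (k : ℤ) (w : M), f' (((A.Y v)[[k]]) w) = ((A.Y (γ v))[[k]]) (f' w) := by
  have := hA.1
  -- Since `γ ^ n = 1`, the power `f ^ n` commutes with all modes; dividing `f` by an `n`-th root of
  -- its scalar normalizes it.
  obtain ⟨c, hc⟩ := hA.exists_eq_smul (f ^ n) fun v k w => by
    rw [pow_apply_mode hf, hγ, Module.End.one_apply]
  have hc0 : c ≠ 0 := by
    rintro rfl
    obtain ⟨w, hw⟩ := exists_ne (0 : M)
    have h0 : (f ^ n) w = (f ^ n) 0 := by rw [hc, zero_smul, map_zero]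
    rw [Module.End.pow_apply, Module.End.pow_apply] at h0
    exact hw (hinj.iterate n h0)
  obtain ⟨z, hz⟩ := IsAlgClosed.exists_pow_nat_eq c (Nat.pos_of_ne_zero hn)
  refine ⟨z⁻¹ • f, ?_, fun v k w => by simp [hf]⟩
  ext w
  rw [smul_pow, LinearMap.smul_apply, hc, inv_pow, hz, smul_smul, inv_mul_cancel₀ hc0, one_smul,
    Module.End.one_apply]

end VertexModule

/-! ### The decomposition of `M` -/

theorem corollary6 {V M : Type*} [AddCommGroup V] [Module ℂ V] [VertexOperatorAlgebra V]
    [AddCommGroup M] [Module ℂ M]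
    (hV : VertexAlgebra.IsSimple V)
    (g : VertexAlgebra.Aut V) (n : ℕ) (hn : 0 < n) (hg : orderOf g = n)
    (A : VertexModule V M) (hA : A.IsIrreducible) (hAg : (A.twist g).IsIso A) :
    ∃ (W : Fin n → Submodule ℂ M)
      (hW : ∀ i, (A.restrictFixedPoints (Subgroup.zpowers g)).IsSubmodule (W i)),
      DirectSum.IsInternal W ∧
      (∀ i, ((A.restrictFixedPoints (Subgroup.zpowers g)).ofSubmodule
        (W i) (hW i)).IsIrreducible) ∧
      (∀ i j, i ≠ j →
        ¬ ((A.restrictFixedPoints (Subgroup.zpowers g)).ofSubmodule (W i) (hW i)).IsIso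
          ((A.restrictFixedPoints (Subgroup.zpowers g)).ofSubmodule (W j) (hW j))) := by
  have hn0 := hn.ne'
  -- The inverse appears because an isomorphism `F` from `M · g` to `M` satisfies `F((gv)_k w) = v_k
  -- F(w)`.
  let γ : Module.End ℂ V := (((g⁻¹ : VertexAlgebra.Aut V) : V ≃ₗ[ℂ] V) : V →ₗ[ℂ] V)
  have hgγ : ∀ v, (g : V ≃ₗ[ℂ] V) (γ v) = v := fun v => LinearEquiv.apply_symm_apply _ v
  have hγg : ∀ v, γ ((g : V ≃ₗ[ℂ] V) v) = v := fun v => LinearEquiv.symm_apply_apply _ v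
  have hpow : ∀ (d : ℕ) (v : V), (γ ^ d) v = (((g⁻¹) ^ d : VertexAlgebra.Aut V) : V ≃ₗ[ℂ] V) v := by
    intro d
    induction d with
    | zero => exact fun v => rfl
    | succ d ih =>
      intro v
      rw [pow_succ', Module.End.mul_apply, ih, pow_succ']
      rfl
  have hpow_iff : ∀ d : ℕ, γ ^ d = 1 ↔ n ∣ d := by
    intro d
    rw [← hg, ← orderOf_inv, orderOf_dvd_iff_pow_eq_one]
    refine ⟨fun h => Subtype.ext (LinearEquiv.ext fun v => ?_), fun h => LinearMap.ext fun v => ?_⟩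
    · rw [← hpow, h]; rfl
    · rw [hpow, h]; rfl
  have hγn : γ ^ n = 1 := (hpow_iff n).2 dvd_rfl
  have hfix : ∀ v, γ v = v ↔ v ∈ VertexAlgebra.fixedPoints (Subgroup.zpowers g) := by
    intro v
    refine ⟨fun h => ?_, fun h => ?_⟩
    · have hle : Subgroup.zpowers g ≤ MulAction.stabilizer (VertexAlgebra.Aut V) v := by
        rw [Subgroup.zpowers_le, MulAction.mem_stabilizer_iff]
        have h1 := hgγ v
        rwa [h] at h1
      exact fun a ha => MulAction.mem_stabilizer_iff.1 (hle ha)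
    · have h1 := hγg v
      rwa [h g (Subgroup.mem_zpowers g)] at h1
  obtain ⟨F, hF⟩ := hAg
  obtain ⟨f, hfn, hf⟩ := hA.exists_pow_eq_one hn0 hγn (f := (F : M →ₗ[ℂ] M)) F.injective
    (fun v k w => by
      have h := hF (γ v) k w
      have h1 : (A.twist g).Y (γ v) = A.Y v := congrArg A.Y (hgγ v)
      rwa [h1] at h)
  obtain ⟨ζ, hζ⟩ : ∃ ζ : ℂ, IsPrimitiveRoot ζ n := ⟨_, Complex.isPrimitiveRoot_exp n hn0⟩
  have hζ0 : ∀ i : ℕ, ζ ^ i ≠ 0 := fun i => pow_ne_zero _ (hζ.ne_zero hn0)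
  have hne : ∀ i : ℕ, f.eigenspace (ζ ^ i) ≠ ⊥ := fun i =>
    hA.eigenspace_ne_bot hV hf (VertexAlgebra.Aut.apply_vacuum g⁻¹)
      (VertexAlgebra.Aut.apply_mode g⁻¹) hn0 hγn (fun d => (hpow_iff d).1) hfn
      (by rw [← pow_mul, mul_comm, pow_mul, hζ.pow_eq_one, one_pow])
  refine ⟨fun i => f.eigenspace (ζ ^ (i : ℕ)), fun i => VertexModule.isSubmodule_eigenspace hf hfix _,
    Module.End.isInternal_eigenspace_of_pow_eq_one hn0 hζ hfn,
    fun i => hA.ofSubmodule_eigenspace hf hn0 hγn hfix (hζ0 i) (hne i) _,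
    fun i j hij => hA.not_isIso_eigenspace hf hn0 hγn hfix (hζ0 i) (hζ0 j)
      (fun h => hij (Fin.ext (hζ.pow_inj i.2 j.2 h))) (hne i) _ _⟩
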